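/- For a lattice $\mathbb L$ let $\mathbb L^*$ be the set of all lattice homomorphisms $x^*\colon\mathbb L\to[-1,1]$. For $f\colon\mathbb L^*\to\mathbb R$ put $$\|f\|=\sup\Big\{\sum_{i=1}^n|f(x_i^*)| : n\in\mathbb N,\ x_1^*,\dots,x_n^*\in\mathbb L^*,\ \sup_{x\in\mathbb L}\sum_{i=1}^n|x_i^*(x)|\le 1\Big\}.$$ The free Banach lattice $FBL\langle\mathbb L\rangle$ generated by $\mathbb L$ is the norm closure of the vector sublattice generated by the evaluations $\delta_x\colon x^*\mapsto x^*(x)$ $(x\in\mathbb L)$ in the Banach lattice of all functions $f\colon\mathbb L^*\to\mathbb R$ with $\|f\|<\infty$ (pointwise order and operations). For a sublattice $\mathbb L\subseteq\mathbb M$, let $\hat\imath\colon FBL\langle\mathbb L\rangle\to FBL\langle\mathbb M\rangle$ be the unique bounded linear lattice homomorphism with $\hat\imath(\delta_x)=\delta_x$ for all $x\in\mathbb L$; explicitly $\hat\imath(f)(y^*)=f(y^*|_{\mathbb L})$. Let $\mathbb M=\{1,2,3\}\times\{1,2,3\}$ with the coordinatewise order, and let $\mathbb L=\{(1,1),(2,2),(2,3),(3,2),(3,3)\}$,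 a sublattice of $\mathbb M$. Then: 1. $\hat\imath\colon FBL\langle\mathbb L\rangle\to FBL\langle\mathbb M\rangle$ is an isomorphic lattice embedding, i.e. a lattice homomorphism for which there is $c>0$ with $c\|f\|\le\|\hat\imath(f)\|$ for all $f\in FBL\langle\mathbb L\rangle$. 2. $\hat\imath$ is not isometric. Moreover, for every $\varepsilon$ with $0<\varepsilon<\frac12$ there is $f\in FBL\langle\mathbb L\rangle$ with $\|f\|\ge\frac{2}{1+\varepsilon}$ and $\|\hat\imath(f)\|\le\frac{1}{1-\varepsilon}$. -/

import Mathlib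

/-- `𝕃*`: the set of all lattice homomorphisms `x* : 𝕃 → [-1,1]`. -/
def LatDual (L : Type*) [Lattice L] : Type _ :=
  {φ : LatticeHom L ℝ // ∀ x, φ x ∈ Set.Icc (-1 : ℝ) 1}

namespace LatDual

/-- Composition of `φ ∈ 𝕄*` with a lattice homomorphism `g : 𝕃 → 𝕄`; for the inclusion of a
sublattice this is the restriction of `φ`. -/
def comp {L M : Type*} [Lattice L] [Lattice M] (φ : LatDual M) (g : LatticeHom L M) : LatDual L :=
  ⟨φ.1.comp g, fun x => φ.2 (g x)⟩

/-- A finite family in `𝕃*` is admissible if `sup_x ∑ᵢ |xᵢ*(x)| ≤ 1`. -/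
def Admissible {L : Type*} [Lattice L] {n : ℕ} (φ : Fin n → LatDual L) : Prop :=
  ∀ x : L, ∑ i, |(φ i).1 x| ≤ 1

end LatDual

/-- The set of all sums `∑ᵢ |f(xᵢ*)|` over admissible finite families. -/
def fblSums {L : Type*} [Lattice L] (f : LatDual L → ℝ) : Set ℝ :=
  {r | ∃ (n : ℕ) (φ : Fin n → LatDual L), LatDual.Admissible φ ∧ r = ∑ i, |f (φ i)|}

/-- `‖f‖`, the supremum of `fblSums f`. It is used only for `f` with `‖f‖ < ∞`, that is, when
`fblSums f` is bounded above. -/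
noncomputable def fblNorm {L : Type*} [Lattice L] (f : LatDual L → ℝ) : ℝ := sSup (fblSums f)

section SumsAPI

variable {L : Type*} [Lattice L]

theorem zero_mem_fblSums (f : LatDual L → ℝ) : (0 : ℝ) ∈ fblSums f :=
  ⟨0, Fin.elim0, fun x => by simp, by simp⟩

theorem fblNorm_nonneg (f : LatDual L → ℝ) : 0 ≤ fblNorm f := by
  apply Real.sSup_nonneg
  rintro r ⟨n, φ, -, rfl⟩
  positivity

theorem sum_le_fblNorm {f : LatDual L → ℝ} (hf : BddAbove (fblSums f)) {n : ℕ}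
    {φ : Fin n → LatDual L} (hφ : LatDual.Admissible φ) : ∑ i, |f (φ i)| ≤ fblNorm f :=
  le_csSup hf ⟨n, φ, hφ, rfl⟩

theorem fblNorm_le {f : LatDual L → ℝ} {C : ℝ}
    (h : ∀ (n : ℕ) (φ : Fin n → LatDual L), LatDual.Admissible φ → ∑ i, |f (φ i)| ≤ C) :
    fblNorm f ≤ C := by
  apply csSup_le ⟨0, zero_mem_fblSums f⟩
  rintro r ⟨n, φ, hφ, rfl⟩
  exact h n φ hφ

theorem bddAbove_fblSums {f : LatDual L → ℝ} {C : ℝ}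
    (h : ∀ (n : ℕ) (φ : Fin n → LatDual L), LatDual.Admissible φ → ∑ i, |f (φ i)| ≤ C) :
    BddAbove (fblSums f) := by
  refine ⟨C, ?_⟩
  rintro r ⟨n, φ, hφ, rfl⟩
  exact h n φ hφ

theorem abs_le_fblNorm {f : LatDual L → ℝ} (hf : BddAbove (fblSums f)) (φ : LatDual L) :
    |f φ| ≤ fblNorm f := by
  have h : LatDual.Admissible (fun _ : Fin 1 => φ) := fun x => by
    simpa using abs_le.2 (φ.2 x)
  simpa using sum_le_fblNorm hf h

theorem sum_add_le {f g : LatDual L → ℝ} (hf : BddAbove (fblSums f)) (hg : BddAbove (fblSums g))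
    (n : ℕ) (φ : Fin n → LatDual L) (hφ : LatDual.Admissible φ) :
    ∑ i, |(f + g) (φ i)| ≤ fblNorm f + fblNorm g := by
  calc ∑ i, |(f + g) (φ i)| ≤ ∑ i, (|f (φ i)| + |g (φ i)|) :=
        Finset.sum_le_sum fun i _ => abs_add_le _ _
    _ = ∑ i, |f (φ i)| + ∑ i, |g (φ i)| := Finset.sum_add_distrib
    _ ≤ _ := add_le_add (sum_le_fblNorm hf hφ) (sum_le_fblNorm hg hφ)

theorem sum_smul_le (c : ℝ) {f : LatDual L → ℝ} (hf : BddAbove (fblSums f))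
    (n : ℕ) (φ : Fin n → LatDual L) (hφ : LatDual.Admissible φ) :
    ∑ i, |(c • f) (φ i)| ≤ |c| * fblNorm f := by
  simp only [Pi.smul_apply, smul_eq_mul, abs_mul, ← Finset.mul_sum]
  exact mul_le_mul_of_nonneg_left (sum_le_fblNorm hf hφ) (abs_nonneg c)

theorem sum_sup_le {f g h : LatDual L → ℝ} (hf : BddAbove (fblSums f)) (hg : BddAbove (fblSums g))
    (hh : ∀ φ, |h φ| ≤ |f φ| + |g φ|) (n : ℕ) (φ : Fin n → LatDual L)
    (hφ : LatDual.Admissible φ) :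
    ∑ i, |h (φ i)| ≤ fblNorm f + fblNorm g := by
  calc ∑ i, |h (φ i)| ≤ ∑ i, (|f (φ i)| + |g (φ i)|) :=
        Finset.sum_le_sum fun i _ => hh _
    _ = ∑ i, |f (φ i)| + ∑ i, |g (φ i)| := Finset.sum_add_distrib
    _ ≤ _ := add_le_add (sum_le_fblNorm hf hφ) (sum_le_fblNorm hg hφ)

end SumsAPI

/-- The linear space of all `f ∈ ℝ^(𝕃*)` with `‖f‖ < ∞`. -/
def fblBddSubmodule (L : Type*) [Lattice L] : Submodule ℝ (LatDual L → ℝ) where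
  carrier := {f | BddAbove (fblSums f)}
  add_mem' := fun hf hg => bddAbove_fblSums (sum_add_le hf hg)
  zero_mem' := bddAbove_fblSums (C := 0) fun n φ _ => by simp
  smul_mem' := fun c _ hf => bddAbove_fblSums (sum_smul_le c hf)

/-- The Banach lattice of all `f ∈ ℝ^(𝕃*)` with `‖f‖ < ∞`, with the pointwise operations and order
and the norm `‖·‖`. It is a new type so that it does not carry the topology of pointwise
convergence. -/
def FBLAmbient (L : Type*) [Lattice L] : Type _ := ↥(fblBddSubmodule L)

namespace FBLAmbient

variable {L : Type*} [Lattice L]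

instance : AddCommGroup (FBLAmbient L) := inferInstanceAs (AddCommGroup ↥(fblBddSubmodule L))

instance : Module ℝ (FBLAmbient L) := inferInstanceAs (Module ℝ ↥(fblBddSubmodule L))

/-- Elements are functions on `𝕃*`. -/
instance : CoeFun (FBLAmbient L) fun _ => LatDual L → ℝ := ⟨fun f => f.1⟩

theorem ext {f g : FBLAmbient L} (h : ∀ φ, f φ = g φ) : f = g := Subtype.ext (funext h)

noncomputable instance : Lattice (FBLAmbient L) :=
  Subtype.lattice (P := fun f : LatDual L → ℝ => f ∈ fblBddSubmodule L)
    (fun f g hf hg => bddAbove_fblSums (sum_sup_le (h := f ⊔ g) hf hg fun φ => by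
      rcases le_total (f φ) (g φ) with h | h <;> simp [h]))
    (fun f g hf hg => bddAbove_fblSums (sum_sup_le (h := f ⊓ g) hf hg fun φ => by
      rcases le_total (f φ) (g φ) with h | h <;> simp [h]))

@[simp] theorem add_apply (f g : FBLAmbient L) (φ : LatDual L) : (f + g) φ = f φ + g φ := rfl
@[simp] theorem sub_apply (f g : FBLAmbient L) (φ : LatDual L) : (f - g) φ = f φ - g φ := rfl
@[simp] theorem neg_apply (f : FBLAmbient L) (φ : LatDual L) : (-f) φ = -f φ := rfl
@[simp] theorem zero_apply (φ : LatDual L) : (0 : FBLAmbient L) φ = 0 := rfl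
@[simp] theorem smul_apply (c : ℝ) (f : FBLAmbient L) (φ : LatDual L) :
    (c • f) φ = c * f φ := rfl
@[simp] theorem sup_apply (f g : FBLAmbient L) (φ : LatDual L) : (f ⊔ g) φ = f φ ⊔ g φ := rfl
@[simp] theorem inf_apply (f g : FBLAmbient L) (φ : LatDual L) : (f ⊓ g) φ = f φ ⊓ g φ := rfl
@[simp] theorem abs_apply (f : FBLAmbient L) (φ : LatDual L) : |f| φ = |f φ| := rfl

theorem le_def {f g : FBLAmbient L} : f ≤ g ↔ ∀ φ, f φ ≤ g φ := Iff.rfl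

instance : IsOrderedAddMonoid (FBLAmbient L) where
  add_le_add_left _ _ h k := fun φ => add_le_add_left (h φ) (k φ)

noncomputable instance : Norm (FBLAmbient L) := ⟨fun f => fblNorm f.1⟩

theorem norm_def (f : FBLAmbient L) : ‖f‖ = fblNorm f.1 := rfl

theorem norm_core : NormedSpace.Core ℝ (FBLAmbient L) where
  norm_nonneg f := fblNorm_nonneg f.1
  norm_smul c f := by
    refine le_antisymm (fblNorm_le (sum_smul_le c f.2)) ?_
    rcases eq_or_ne c 0 with rfl | hc
    · rw [norm_zero, zero_mul]
      exact fblNorm_nonneg _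
    · have h := fblNorm_le (sum_smul_le c⁻¹ (c • f).2)
      have h2 : c⁻¹ • (c • f).1 = f.1 := by
        change c⁻¹ • (c • f.1) = f.1
        rw [smul_smul, inv_mul_cancel₀ hc, one_smul]
      rw [h2, abs_inv] at h
      rw [Real.norm_eq_abs, norm_def, norm_def]
      have hc' : 0 < |c| := abs_pos.2 hc
      calc |c| * fblNorm f.1 ≤ |c| * (|c|⁻¹ * fblNorm (c • f).1) :=
            mul_le_mul_of_nonneg_left h hc'.le
        _ = _ := by rw [← mul_assoc, mul_inv_cancel₀ hc'.ne', one_mul]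
  norm_triangle f g := fblNorm_le (sum_add_le f.2 g.2)
  norm_eq_zero_iff f := by
    constructor
    · intro h
      apply ext
      intro φ
      have := abs_le_fblNorm f.2 φ
      rw [← norm_def, h] at this
      exact abs_nonpos_iff.1 this
    · rintro rfl
      refine le_antisymm (fblNorm_le fun n φ _ => ?_) (fblNorm_nonneg _)
      change ∑ i : Fin n, |(0 : ℝ)| ≤ 0
      simp

noncomputable instance : NormedAddCommGroup (FBLAmbient L) := NormedAddCommGroup.ofCore norm_core

noncomputable instance : NormedSpace ℝ (FBLAmbient L) := NormedSpace.ofCore norm_core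

theorem abs_apply_le_norm (f : FBLAmbient L) (φ : LatDual L) : |f φ| ≤ ‖f‖ :=
  abs_le_fblNorm f.2 φ

instance : HasSolidNorm (FBLAmbient L) where
  solid _ g h := fblNorm_le fun _ φ hφ =>
    (Finset.sum_le_sum fun i _ => h (φ i)).trans (sum_le_fblNorm g.2 hφ)

instance : CompleteSpace (FBLAmbient L) := by
  apply Metric.complete_of_cauchySeq_tendsto
  intro u hu
  have hpt : ∀ φ : LatDual L, CauchySeq fun k => u k φ := by
    intro φ
    rw [Metric.cauchySeq_iff'] at hu ⊢
    intro ε hε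
    obtain ⟨N, hN⟩ := hu ε hε
    refine ⟨N, fun n hn => lt_of_le_of_lt ?_ (hN n hn)⟩
    rw [Real.dist_eq, dist_eq_norm]
    exact abs_apply_le_norm (u n - u N) φ
  choose F hF using fun φ => cauchySeq_tendsto_of_complete (hpt φ)
  -- uniform tail estimate for the pointwise limit
  have key : ∀ ε > 0, ∃ N, ∀ k ≥ N, ∀ (n : ℕ) (φ : Fin n → LatDual L), LatDual.Admissible φ →
      ∑ i, |(u k).1 (φ i) - F (φ i)| ≤ ε := by
    intro ε hε
    obtain ⟨N, hN⟩ := Metric.cauchySeq_iff.1 hu ε hε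
    refine ⟨N, fun k hk n φ hφ => ?_⟩
    have ht : Filter.Tendsto (fun m => ∑ i, |(u k).1 (φ i) - (u m).1 (φ i)|) Filter.atTop
        (nhds (∑ i, |(u k).1 (φ i) - F (φ i)|)) :=
      tendsto_finsetSum _ fun i _ => (tendsto_const_nhds.sub (hF (φ i))).abs
    refine le_of_tendsto ht (Filter.eventually_atTop.2 ⟨N, fun m hm => ?_⟩)
    have h1 := hN k hk m hm
    rw [dist_eq_norm] at h1
    exact (sum_le_fblNorm (u k - u m).2 hφ).trans h1.le
  have hFb : BddAbove (fblSums F) := by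
    obtain ⟨N, hN⟩ := key 1 one_pos
    refine bddAbove_fblSums (C := 1 + ‖u N‖) fun n φ hφ => ?_
    calc ∑ i, |F (φ i)| ≤ ∑ i, (|(u N).1 (φ i) - F (φ i)| + |(u N).1 (φ i)|) := by
          refine Finset.sum_le_sum fun i _ => ?_
          have := abs_sub_abs_le_abs_sub (F (φ i)) ((u N).1 (φ i))
          rw [abs_sub_comm] at this
          linarith
      _ = _ := Finset.sum_add_distrib
      _ ≤ _ := add_le_add (hN N le_rfl n φ hφ) (sum_le_fblNorm (u N).2 hφ)
  let G : FBLAmbient L := ⟨F, hFb⟩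
  refine ⟨G, Metric.tendsto_atTop.2 fun ε hε => ?_⟩
  obtain ⟨N, hN⟩ := key (ε / 2) (half_pos hε)
  refine ⟨N, fun k hk => lt_of_le_of_lt ?_ (half_lt_self hε)⟩
  rw [dist_eq_norm]
  exact fblNorm_le (hN k hk)

/-- The evaluation function `δ_x`, `δ_x(x*) = x*(x)`. -/
def delta (x : L) : FBLAmbient L :=
  ⟨fun φ => φ.1 x, bddAbove_fblSums (C := 1) fun _ _ hφ => hφ x⟩

@[simp] theorem delta_apply (x : L) (φ : LatDual L) : delta x φ = φ.1 x := rfl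

end FBLAmbient

/-- A linear subspace of a vector lattice is a vector sublattice if it is closed under `⊔`
and `⊓`. -/
def IsVectorSublattice {E : Type*} [AddCommGroup E] [Module ℝ E] [Lattice E]
    (S : Submodule ℝ E) : Prop :=
  ∀ f ∈ S, ∀ g ∈ S, f ⊔ g ∈ S ∧ f ⊓ g ∈ S

/-- The vector sublattice generated by a set `A`. -/
def vectorSublatticeSpan {E : Type*} [AddCommGroup E] [Module ℝ E] [Lattice E]
    (A : Set E) : Submodule ℝ E :=
  sInf {S | IsVectorSublattice S ∧ A ⊆ S}

theorem isVectorSublattice_span {E : Type*} [AddCommGroup E] [Module ℝ E] [Lattice E]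
    (A : Set E) : IsVectorSublattice (vectorSublatticeSpan A) := by
  intro f hf g hg
  simp only [vectorSublatticeSpan, Submodule.mem_sInf, Set.mem_ofPred_eq] at hf hg ⊢
  exact ⟨fun S hS => (hS.1 f (hf S hS) g (hg S hS)).1, fun S hS => (hS.1 f (hf S hS) g (hg S hS)).2⟩

theorem subset_vectorSublatticeSpan {E : Type*} [AddCommGroup E] [Module ℝ E] [Lattice E]
    (A : Set E) : A ⊆ vectorSublatticeSpan A := fun a ha => by
  simp only [vectorSublatticeSpan, SetLike.mem_coe, Submodule.mem_sInf, Set.mem_ofPred_eq]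
  exact fun S hS => hS.2 ha

theorem vectorSublatticeSpan_le {E : Type*} [AddCommGroup E] [Module ℝ E] [Lattice E]
    {A : Set E} {S : Submodule ℝ E} (hS : IsVectorSublattice S) (h : A ⊆ S) :
    vectorSublatticeSpan A ≤ S := sInf_le ⟨hS, h⟩

/-- The norm closure of the vector sublattice generated by the evaluations `δ_x`, `x ∈ 𝕃`. -/
noncomputable def fblSubmodule (L : Type*) [Lattice L] : Submodule ℝ (FBLAmbient L) :=
  (vectorSublatticeSpan (Set.range (FBLAmbient.delta (L := L)))).topologicalClosure

theorem isVectorSublattice_closure {E : Type*} [NormedAddCommGroup E] [NormedSpace ℝ E] [Lattice E]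
    [HasSolidNorm E] [IsOrderedAddMonoid E] {S : Submodule ℝ E} (hS : IsVectorSublattice S) :
    IsVectorSublattice S.topologicalClosure := by
  intro f hf g hg
  exact ⟨map_mem_closure₂ continuous_sup hf hg fun a ha b hb => (hS a ha b hb).1,
    map_mem_closure₂ continuous_inf hf hg fun a ha b hb => (hS a ha b hb).2⟩

/-- The free Banach lattice `FBL⟨𝕃⟩` generated by the lattice `𝕃`, as a Banach lattice of
functions on `𝕃*`. -/
def FBL (L : Type*) [Lattice L] : Type _ := ↥(fblSubmodule L)

namespace FBL

variable {L M : Type*} [Lattice L] [Lattice M]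

noncomputable instance : NormedAddCommGroup (FBL L) :=
  inferInstanceAs (NormedAddCommGroup ↥(fblSubmodule L))

noncomputable instance : NormedSpace ℝ (FBL L) :=
  inferInstanceAs (NormedSpace ℝ ↥(fblSubmodule L))

theorem isVectorSublattice : IsVectorSublattice (fblSubmodule L) :=
  isVectorSublattice_closure (isVectorSublattice_span _)

noncomputable instance : Lattice (FBL L) :=
  Subtype.lattice (P := fun f : FBLAmbient L => f ∈ fblSubmodule L)
    (fun f g hf hg => (isVectorSublattice f hf g hg).1)
    (fun f g hf hg => (isVectorSublattice f hf g hg).2)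

instance : IsOrderedAddMonoid (FBL L) where
  add_le_add_left _ _ h k := add_le_add_left (α := FBLAmbient L) h k.1

instance : HasSolidNorm (FBL L) where
  solid f g h := HasSolidNorm.solid (α := FBLAmbient L) (x := f.1) (y := g.1) h

instance : CompleteSpace (FBL L) :=
  (Submodule.isClosed_topologicalClosure _).completeSpace_coe

/-- The canonical map `δ_𝕃 : 𝕃 → FBL⟨𝕃⟩`, `x ↦ δ_x`. -/
noncomputable def of (x : L) : FBL L :=
  ⟨FBLAmbient.delta x, Submodule.le_topologicalClosure _ (subset_vectorSublatticeSpan _ ⟨x, rfl⟩)⟩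

/-- Elements of `FBL⟨𝕃⟩` are functions on `𝕃*`. -/
instance : CoeFun (FBL L) fun _ => LatDual L → ℝ := ⟨fun f => f.1.1⟩

@[simp] theorem of_apply (x : L) (φ : LatDual L) : of x φ = φ.1 x := rfl
@[simp] theorem add_apply (f g : FBL L) (φ : LatDual L) : (f + g) φ = f φ + g φ := rfl
@[simp] theorem smul_apply (c : ℝ) (f : FBL L) (φ : LatDual L) : (c • f) φ = c * f φ := rfl
@[simp] theorem sup_apply (f g : FBL L) (φ : LatDual L) : (f ⊔ g) φ = f φ ⊔ g φ := rfl
@[simp] theorem inf_apply (f g : FBL L) (φ : LatDual L) : (f ⊓ g) φ = f φ ⊓ g φ := rfl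

theorem norm_def (f : FBL L) : ‖f‖ = sSup (fblSums (f : LatDual L → ℝ)) := rfl

theorem ext {f g : FBL L} (h : ∀ φ, f φ = g φ) : f = g := Subtype.ext (FBLAmbient.ext h)

theorem of_sup (x y : L) : of (x ⊔ y) = of x ⊔ of y := ext fun φ => map_sup φ.1 x y

theorem of_inf (x y : L) : of (x ⊓ y) = of x ⊓ of y := ext fun φ => map_inf φ.1 x y

end FBL

/-- A bounded linear operator between Banach lattices is a Banach lattice homomorphism if it
preserves `⊔` and `⊓`. -/
def IsBanachLatticeHom {E F : Type*} [NormedAddCommGroup E] [NormedSpace ℝ E] [Lattice E]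
    [NormedAddCommGroup F] [NormedSpace ℝ F] [Lattice F] (T : E →L[ℝ] F) : Prop :=
  ∀ f g, T (f ⊔ g) = T f ⊔ T g ∧ T (f ⊓ g) = T f ⊓ T g

/-- An isomorphic lattice embedding: a Banach lattice homomorphism that is bounded below, that is,
an isomorphism onto its range. -/
def IsIsomorphicLatticeEmbedding {E F : Type*} [NormedAddCommGroup E] [NormedSpace ℝ E] [Lattice E]
    [NormedAddCommGroup F] [NormedSpace ℝ F] [Lattice F] (T : E →L[ℝ] F) : Prop :=
  IsBanachLatticeHom T ∧ ∃ c : ℝ, 0 < c ∧ ∀ f, c * ‖f‖ ≤ ‖T f‖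

/-- Composition with `g` as an operator between the ambient function lattices. -/
noncomputable def FBLAmbient.map {L M : Type*} [Lattice L] [Lattice M] (g : LatticeHom L M) :
    FBLAmbient L →L[ℝ] FBLAmbient M :=
  LinearMap.mkContinuous
    { toFun := fun f => ⟨fun φ => f (φ.comp g), bddAbove_fblSums (C := ‖f‖) fun _ _ hφ =>
        sum_le_fblNorm f.2 fun x => hφ (g x)⟩
      map_add' := fun _ _ => rfl
      map_smul' := fun _ _ => rfl }
    1 fun f => by
      rw [one_mul]
      exact fblNorm_le fun n φ hφ =>
        sum_le_fblNorm (φ := fun i => (φ i).comp g) f.2 fun x => hφ (g x)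

theorem FBLAmbient.map_mem {L M : Type*} [Lattice L] [Lattice M] (g : LatticeHom L M) :
    ∀ f ∈ fblSubmodule L, FBLAmbient.map g f ∈ fblSubmodule M := by
  intro f hf
  have h : vectorSublatticeSpan (Set.range (FBLAmbient.delta (L := L))) ≤
      (fblSubmodule M).comap (FBLAmbient.map g).toLinearMap := by
    apply vectorSublatticeSpan_le
    · intro a ha b hb
      exact FBL.isVectorSublattice _ ha _ hb
    · rintro _ ⟨x, rfl⟩
      exact (FBL.of (g x)).2
  have hc : IsClosed ((FBLAmbient.map g) ⁻¹' (fblSubmodule M : Set (FBLAmbient M))) :=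
    (Submodule.isClosed_topologicalClosure _).preimage (FBLAmbient.map g).continuous
  exact closure_minimal (fun a ha => h ha) hc hf

namespace FBL

variable {L M : Type*} [Lattice L] [Lattice M]

/-- The operator `ĝ : FBL⟨𝕃⟩ → FBL⟨𝕄⟩` induced by a lattice homomorphism `g : 𝕃 → 𝕄`; on functions
it is `ĝ(f)(y*) = f(y* ∘ g)`. It is the unique Banach lattice homomorphism with
`ĝ(δ_x) = δ_{g x}`: see `map_of`, `map_sup`, `map_inf` and `map_unique`. -/
noncomputable def map (g : LatticeHom L M) : FBL L →L[ℝ] FBL M :=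
  (FBLAmbient.map g).restrict (FBLAmbient.map_mem g)

@[simp] theorem map_apply (g : LatticeHom L M) (f : FBL L) (φ : LatDual M) :
    map g f φ = f (φ.comp g) := rfl

theorem map_of (g : LatticeHom L M) (x : L) : map g (of x) = of (g x) := rfl

theorem isBanachLatticeHom_map (g : LatticeHom L M) : IsBanachLatticeHom (map g) :=
  fun _ _ => ⟨rfl, rfl⟩

theorem map_unique (g : LatticeHom L M) (T : FBL L →L[ℝ] FBL M) (hT : IsBanachLatticeHom T)
    (hof : ∀ x, T (of x) = of (g x)) : T = map g := by
  -- the equalizer, as a subset of the ambient space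
  have key : ∀ (f : FBLAmbient L),
      f ∈ vectorSublatticeSpan (Set.range (FBLAmbient.delta (L := L))) →
      ∀ hf : f ∈ fblSubmodule L, T ⟨f, hf⟩ = map g ⟨f, hf⟩ := by
    let Q : Submodule ℝ (FBL L) := LinearMap.eqLocus T.toLinearMap (map g).toLinearMap
    have hQ : IsVectorSublattice Q := by
      intro a ha b hb
      have ha' : T a = map g a := ha
      have hb' : T b = map g b := hb
      constructor
      · change T (a ⊔ b) = map g (a ⊔ b)
        rw [(hT a b).1, (isBanachLatticeHom_map g a b).1, ha', hb']
      · change T (a ⊓ b) = map g (a ⊓ b)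
        rw [(hT a b).2, (isBanachLatticeHom_map g a b).2, ha', hb']
    have hle : vectorSublatticeSpan (Set.range (FBLAmbient.delta (L := L))) ≤
        Submodule.map (fblSubmodule L).subtype Q := by
      apply vectorSublatticeSpan_le
      · rintro _ ⟨(a : FBL L), ha, rfl⟩ _ ⟨(b : FBL L), hb, rfl⟩
        exact ⟨⟨(a ⊔ b : FBL L), (hQ a ha b hb).1, rfl⟩, ⟨(a ⊓ b : FBL L), (hQ a ha b hb).2, rfl⟩⟩
      · rintro _ ⟨x, rfl⟩
        exact ⟨of x, hof x, rfl⟩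
    intro f hf hf'
    obtain ⟨a, ha, rfl⟩ := hle hf
    exact ha
  ext1 f
  obtain ⟨f, hf⟩ := f
  have hf2 : f ∈ closure (vectorSublatticeSpan (Set.range (FBLAmbient.delta (L := L))) :
      Set (FBLAmbient L)) := hf
  rw [mem_closure_iff_seq_limit] at hf2
  obtain ⟨u, hu, hlim⟩ := hf2
  let v : ℕ → FBL L := fun k => ⟨u k, Submodule.le_topologicalClosure _ (hu k)⟩
  have hv : Filter.Tendsto v Filter.atTop (nhds (⟨f, hf⟩ : FBL L)) := tendsto_subtype_rng.2 hlim
  refine tendsto_nhds_unique ((T.continuous.tendsto _).comp hv) ?_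
  refine (((map g).continuous.tendsto _).comp hv).congr fun k => ?_
  exact (key (u k) (hu k) _).symm

end FBL

/-- The lattice `𝕄 = {1,2,3} × {1,2,3}` with the coordinatewise order; the elements `0 < 1 < 2` of
`Fin 3` stand for `1 < 2 < 3`. -/
abbrev GridM : Type := Fin 3 × Fin 3

/-- The sublattice `𝕃 = {(1,1), (2,2), (2,3), (3,2), (3,3)}` of `𝕄`, each coordinate being lowered
by `1` as in `GridM`. -/
def gridL : Sublattice GridM where
  carrier := {(0, 0), (1, 1), (1, 2), (2, 1), (2, 2)}
  supClosed' := by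
    simp only [SupClosed, Set.mem_insert_iff, Set.mem_singleton_iff]
    decide
  infClosed' := by
    simp only [InfClosed, Set.mem_insert_iff, Set.mem_singleton_iff]
    decide

/-! Embedding: the values of `φ ∈ 𝕃*` at (2,3) and (3,2) are comparable reals, and these points have
infimum (2,2) and supremum (3,3). So `φ` identifies one of them with (2,2) and the other with (3,3),
and it factors through a three-element chain. One coordinate of `𝕄` maps onto that chain, so `φ`
extends to `𝕄` by composition with `projFst` or `projSnd`. Extending a whole admissible family by
one fixed projection keeps it admissible, and two projections suffice, which gives the constant
`1/2` (`norm_le_two_mul_norm_map`).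

Failure of isometry: the witness is controlled by the value at (1,1) when (2,3) is below (3,2), and
by the value at (3,3) in the opposite case. A homomorphism on `𝕄` has at (1,3) exactly the value
that matters (`abs_witness_comp_le`), so admissibility at this one point bounds the image by 1. No
point of `𝕃` plays this role: one homomorphism of size `t` at (1,1) and another of size `t` at (3,3)
are jointly admissible for `t` close to 1 (`le_norm_witness`). -/

namespace GridL

/-! ### The five elements of `𝕃` -/

/-- Membership in `gridL`, in a decidable form. -/
theorem mem_iff {x : GridM} : x ∈ gridL ↔
    x = (0, 0) ∨ x = (1, 1) ∨ x = (1, 2) ∨ x = (2, 1) ∨ x = (2, 2) := Iff.rfl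

/-- The bottom element `(1,1)` of `gridL`. -/
def bot : gridL := ⟨(0, 0), mem_iff.2 (by decide)⟩

/-- The element `(2,2)` of `gridL`. -/
def mid : gridL := ⟨(1, 1), mem_iff.2 (by decide)⟩

/-- The element `(2,3)` of `gridL`. -/
def left : gridL := ⟨(1, 2), mem_iff.2 (by decide)⟩

/-- The element `(3,2)` of `gridL`. -/
def right : gridL := ⟨(2, 1), mem_iff.2 (by decide)⟩

/-- The top element `(3,3)` of `gridL`. -/
def top : gridL := ⟨(2, 2), mem_iff.2 (by decide)⟩

theorem cases (x : gridL) : x = bot ∨ x = mid ∨ x = left ∨ x = right ∨ x = top := by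
  obtain ⟨x, hx⟩ := x
  rcases mem_iff.1 hx with rfl | rfl | rfl | rfl | rfl
  exacts [.inl rfl, .inr (.inl rfl), .inr (.inr (.inl rfl)), .inr (.inr (.inr (.inl rfl))),
    .inr (.inr (.inr (.inr rfl)))]

theorem left_inf_right : left ⊓ right = mid := Subtype.ext (by decide)

theorem left_sup_right : left ⊔ right = top := Subtype.ext (by decide)

/-! ### Extending homomorphisms from `𝕃` to `𝕄` -/

/-- The lattice homomorphism `𝕄 → 𝕃`, `(i, j) ↦ (1,1), (2,2), (3,2)` for `i = 1, 2, 3`. -/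
def projFst : LatticeHom GridM gridL where
  toFun x := ⟨![(0, 0), (1, 1), (2, 1)] x.1, mem_iff.2 (by revert x; decide)⟩
  map_sup' x y := Subtype.ext (by revert x y; decide)
  map_inf' x y := Subtype.ext (by revert x y; decide)

/-- The lattice homomorphism `𝕄 → 𝕃`, `(i, j) ↦ (1,1), (2,2), (2,3)` for `j = 1, 2, 3`. -/
def projSnd : LatticeHom GridM gridL where
  toFun x := ⟨![(0, 0), (1, 1), (1, 2)] x.2, mem_iff.2 (by revert x; decide)⟩
  map_sup' x y := Subtype.ext (by revert x y; decide)
  map_inf' x y := Subtype.ext (by revert x y; decide)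

/-- On `𝕃`, `projFst` only moves `left` to `mid` and `top` to `right`, and under `h` these are pairs
on which `φ` agrees. -/
theorem comp_projFst {φ : LatDual gridL} (h : φ.1 left ≤ φ.1 right) :
    (φ.comp projFst).comp gridL.subtype = φ := by
  have h1 : φ.1 mid = φ.1 left := by rw [← left_inf_right, map_inf, inf_eq_left.2 h]
  have h2 : φ.1 top = φ.1 right := by rw [← left_sup_right, map_sup, sup_eq_right.2 h]
  refine Subtype.ext (LatticeHom.ext fun x => ?_)
  rcases cases x with rfl | rfl | rfl | rfl | rfl
  exacts [rfl, rfl, h1, rfl, h2.symm]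

theorem comp_projSnd {φ : LatDual gridL} (h : φ.1 right ≤ φ.1 left) :
    (φ.comp projSnd).comp gridL.subtype = φ := by
  have h1 : φ.1 mid = φ.1 right := by rw [← left_inf_right, map_inf, inf_eq_right.2 h]
  have h2 : φ.1 top = φ.1 left := by rw [← left_sup_right, map_sup, sup_eq_left.2 h]
  refine Subtype.ext (LatticeHom.ext fun x => ?_)
  rcases cases x with rfl | rfl | rfl | rfl | rfl
  exacts [rfl, rfl, rfl, h1, h2.symm]

/-! ### Homomorphisms on `𝕃` from three values -/

/-- The homomorphism on `gridL` with prescribed values at `(1,1)`, `(2,3)` and `(3,2)`. -/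
def mkDual (a c d : ℝ) (ha : -1 ≤ a) (hac : a ≤ c) (had : a ≤ d) (hc : c ≤ 1) (hd : d ≤ 1) :
    LatDual gridL := by
  -- The values at `mid` and `top` are forced. The last branch serves `top`; its value at points
  -- outside `𝕃` is irrelevant.
  let v : GridM → ℝ := fun x =>
    if x = (0, 0) then a else if x = (1, 1) then c ⊓ d else if x = (1, 2) then c
      else if x = (2, 1) then d else c ⊔ d
  have key : ∀ x ∈ gridL, ∀ y ∈ gridL, v (x ⊔ y) = v x ⊔ v y ∧ v (x ⊓ y) = v x ⊓ v y := by
    have h0 : a ≤ c ⊓ d := le_inf hac had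
    have h1 : a ≤ c ⊔ d := hac.trans le_sup_left
    have h2 : c ⊓ d ≤ c ⊔ d := inf_le_left.trans le_sup_left
    intro x hx y hy
    rcases mem_iff.1 hx with rfl | rfl | rfl | rfl | rfl <;>
    rcases mem_iff.1 hy with rfl | rfl | rfl | rfl | rfl <;>
    simp [v, Prod.ext_iff, hac, had, h0, h1, h2, inf_comm d c, sup_comm d c,
      show (1 : Fin 3) ≤ 2 by decide]
  exact ⟨⟨⟨fun x => v x, fun x y => (key x x.2 y y.2).1⟩, fun x y => (key x x.2 y y.2).2⟩,
    fun x => by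
      have hb : ∀ z : ℝ, a ≤ z → z ≤ 1 → z ∈ Set.Icc (-1 : ℝ) 1 := fun z h h' => ⟨ha.trans h, h'⟩
      change v x ∈ _
      dsimp only [v]
      split_ifs
      exacts [hb _ le_rfl (hac.trans hc), hb _ (le_inf hac had) (inf_le_left.trans hc),
        hb _ hac hc, hb _ had hd, hb _ (hac.trans le_sup_left) (sup_le hc hd)]⟩

section mkDual

variable {a c d : ℝ} {ha : -1 ≤ a} {hac : a ≤ c} {had : a ≤ d} {hc : c ≤ 1} {hd : d ≤ 1}

theorem mkDual_bot : (mkDual a c d ha hac had hc hd).1 bot = a := rfl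

theorem mkDual_left : (mkDual a c d ha hac had hc hd).1 left = c := rfl

theorem mkDual_right : (mkDual a c d ha hac had hc hd).1 right = d := rfl

theorem mkDual_mid : (mkDual a c d ha hac had hc hd).1 mid = c ⊓ d := rfl

theorem mkDual_top : (mkDual a c d ha hac had hc hd).1 top = c ⊔ d := rfl

end mkDual

/-! ### The lower bound for the embedding -/

/-- The norm on `FBL⟨𝕃⟩` is at most twice the norm of the image in `FBL⟨𝕄⟩`: every
homomorphism on `𝕃` extends to `𝕄` through one of the two projections. -/
theorem norm_le_two_mul_norm_map (f : FBL gridL) : ‖f‖ ≤ 2 * ‖FBL.map gridL.subtype f‖ := by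
  refine fblNorm_le fun n φ hφ => ?_
  have h (g : LatticeHom GridM gridL) :
      ∑ i, |f (((φ i).comp g).comp gridL.subtype)| ≤ ‖FBL.map gridL.subtype f‖ :=
    sum_le_fblNorm (φ := fun i => (φ i).comp g) (FBL.map gridL.subtype f).1.2 fun x => hφ (g x)
  -- The family need not be split: both compositions are summed over all `i`, and for each `i` one
  -- of them is `φ i` itself.
  calc ∑ i, |f (φ i)|
      ≤ ∑ i, (|f (((φ i).comp projFst).comp gridL.subtype)| +
          |f (((φ i).comp projSnd).comp gridL.subtype)|) := by
        refine Finset.sum_le_sum fun i _ => ?_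
        rcases le_total ((φ i).1 left) ((φ i).1 right) with hi | hi
        · rw [comp_projFst hi]
          exact le_add_of_nonneg_right (abs_nonneg _)
        · rw [comp_projSnd hi]
          exact le_add_of_nonneg_left (abs_nonneg _)
    _ ≤ 2 * ‖FBL.map gridL.subtype f‖ := by
        rw [Finset.sum_add_distrib, two_mul]
        exact add_le_add (h _) (h _)

/-! ### The witness against isometry -/

/-- The function `δ₁₁⁻ ∧ ε⁻¹(δ₃₂ - δ₂₃)⁺ + δ₃₃⁺ ∧ (δ₂₃ - δ₃₂)⁺`. -/
noncomputable def witness (ε : ℝ) : FBL gridL :=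
  ((-1 : ℝ) • FBL.of bot ⊔ (0 : ℝ) • FBL.of bot) ⊓
      ε⁻¹ • ((FBL.of right + (-1 : ℝ) • FBL.of left) ⊔ (0 : ℝ) • FBL.of bot) +
    (FBL.of top ⊔ (0 : ℝ) • FBL.of bot) ⊓
      ((FBL.of left + (-1 : ℝ) • FBL.of right) ⊔ (0 : ℝ) • FBL.of bot)

theorem witness_apply (ε : ℝ) (φ : LatDual gridL) :
    witness ε φ = max (-φ.1 bot) 0 ⊓ (ε⁻¹ * max (φ.1 right - φ.1 left) 0) +
      max (φ.1 top) 0 ⊓ max (φ.1 left - φ.1 right) 0 := by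
  simp only [witness, FBL.add_apply, FBL.smul_apply, FBL.sup_apply, FBL.inf_apply, FBL.of_apply,
    neg_mul, one_mul, zero_mul, sub_eq_add_neg]

/-- The two summands of the witness live on opposite signs of `φ right - φ left`. Here only the
first survives, and it is capped by the negative part at `bot`. -/
theorem abs_witness_le_of_le {ε : ℝ} (hε : 0 < ε) {φ : LatDual gridL}
    (h : φ.1 left ≤ φ.1 right) : |witness ε φ| ≤ |φ.1 bot| := by
  have h1 : 0 ≤ ε⁻¹ * max (φ.1 right - φ.1 left) 0 := by positivity
  rw [witness_apply, max_eq_right (sub_nonpos.2 h), inf_eq_right.2 (le_max_right (φ.1 top) 0), add_zero,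
    abs_of_nonneg (le_inf (le_max_right _ _) h1)]
  exact inf_le_left.trans (max_le (neg_le_abs _) (abs_nonneg _))

theorem abs_witness_le_of_ge {ε : ℝ} {φ : LatDual gridL}
    (h : φ.1 right ≤ φ.1 left) : |witness ε φ| ≤ |φ.1 top| := by
  rw [witness_apply, max_eq_right (sub_nonpos.2 h), mul_zero, inf_eq_right.2 (le_max_right _ _),
    zero_add, abs_of_nonneg (le_inf (le_max_right _ _) (le_max_right _ _))]
  exact inf_le_left.trans (max_le (le_abs_self _) (abs_nonneg _))

/-- The value of the witness at the restriction of `ψ` is controlled by the single value of `ψ`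
at `(1,3)`. -/
theorem abs_witness_comp_le {ε : ℝ} (hε : 0 < ε) (ψ : LatDual GridM) :
    |witness ε (ψ.comp gridL.subtype)| ≤ |ψ.1 (0, 2)| := by
  have hinf : ψ.1 (0, 0) = ψ.1 (0, 2) ⊓ ψ.1 (2, 0) := by
    rw [← map_inf, show ((0, 2) ⊓ (2, 0) : GridM) = (0, 0) by decide]
  have hsup : ψ.1 (2, 2) = ψ.1 (0, 2) ⊔ ψ.1 (2, 0) := by
    rw [← map_sup, show ((0, 2) ⊔ (2, 0) : GridM) = (2, 2) by decide]
  have hmono : Monotone ψ.1 := OrderHomClass.mono ψ.1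
  -- The corners `(0, 2)` and `(2, 0)` carry the values of `ψ` at bottom and top in some order. The
  -- corner with the top value forces the neighbouring point of `𝕃` to have it too, which decides
  -- the order of `left` and `right`.
  rcases le_total (ψ.1 (0, 2)) (ψ.1 (2, 0)) with h | h
  · rw [inf_eq_left.2 h] at hinf
    rw [sup_eq_right.2 h] at hsup
    rw [← hinf]
    refine abs_witness_le_of_le hε ?_
    calc ψ.1 (1, 2) ≤ ψ.1 (2, 2) := hmono (by decide)
      _ = ψ.1 (2, 0) := hsup
      _ ≤ ψ.1 (2, 1) := hmono (by decide)
  · rw [sup_eq_left.2 h] at hsup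
    rw [← hsup]
    refine abs_witness_le_of_ge ?_
    calc ψ.1 (2, 1) ≤ ψ.1 (2, 2) := hmono (by decide)
      _ = ψ.1 (0, 2) := hsup
      _ ≤ ψ.1 (1, 2) := hmono (by decide)

theorem norm_map_witness_le {ε : ℝ} (hε : 0 < ε) :
    ‖FBL.map gridL.subtype (witness ε)‖ ≤ 1 :=
  fblNorm_le fun _ ψ hψ =>
    (Finset.sum_le_sum fun i _ => abs_witness_comp_le hε (ψ i)).trans (hψ (0, 2))

theorem le_norm_witness {ε : ℝ} (hε : 0 < ε) : 2 / (1 + ε) ≤ ‖witness ε‖ := by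
  have hpos : 0 < 1 + ε := by linarith
  -- The tightest admissibility constraint for `x` and `y` below is at `top`, where the sum is `t *
  -- ε + t`.
  obtain ⟨t, ht⟩ : ∃ t, t = (1 + ε)⁻¹ := ⟨_, rfl⟩
  have ht0 : 0 < t := ht ▸ inv_pos.2 hpos
  have hts : t + t * ε = 1 := by
    rw [ht, ← mul_one_add, inv_mul_cancel₀ hpos.ne']
  have htε : 0 < t * ε := mul_pos ht0 hε
  -- `x` is large only at `bot`: a gap of `t * ε` between `left` and `right` is enough, since the
  -- factor `ε⁻¹` restores it to `t`. `y` vanishes at `bot`, so the two do not compete there.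
  let x : LatDual gridL := mkDual (-t) 0 (t * ε) (by linarith) (by linarith) (by linarith)
    zero_le_one (by linarith)
  let y : LatDual gridL := mkDual 0 t 0 (by norm_num) ht0.le le_rfl (by linarith) zero_le_one
  have hxy : LatDual.Admissible ![x, y] := by
    intro z
    rw [Fin.sum_univ_two]
    change |x.1 z| + |y.1 z| ≤ 1
    rcases cases z with rfl | rfl | rfl | rfl | rfl <;>
      simp only [x, y, mkDual_bot, mkDual_mid, mkDual_left, mkDual_right, mkDual_top,
        inf_eq_left.2 htε.le, inf_eq_right.2 ht0.le, sup_eq_right.2 htε.le, sup_eq_left.2 ht0.le,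
        abs_neg, abs_zero, abs_of_pos ht0, abs_of_pos htε] <;> linarith
  have hx : witness ε x = t := by
    have h : ε⁻¹ * (t * ε) = t := by field_simp
    rw [witness_apply]
    simp only [x, mkDual_bot, mkDual_left, mkDual_right, neg_neg, sub_zero, zero_sub,
      max_eq_left ht0.le, max_eq_left htε.le, max_eq_right (neg_nonpos.2 htε.le), h]
    simp
  have hy : witness ε y = t := by
    rw [witness_apply]
    simp [y, mkDual_bot, mkDual_left, mkDual_right, mkDual_top, ht0.le]
  have h := sum_le_fblNorm (witness ε).1.2 hxy
  rw [Fin.sum_univ_two] at h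
  change |witness ε x| + |witness ε y| ≤ ‖witness ε‖ at h
  rw [hx, hy, abs_of_pos ht0] at h
  rw [div_eq_mul_inv, ← ht, two_mul]
  exact h

end GridL

open GridL in
theorem proposition5p2 :
    IsIsomorphicLatticeEmbedding (FBL.map gridL.subtype) ∧
    ¬ Isometry (FBL.map gridL.subtype) ∧
    ∀ ε : ℝ, 0 < ε → ε < 1 / 2 → ∃ f : FBL gridL,
      2 / (1 + ε) ≤ ‖f‖ ∧ ‖FBL.map gridL.subtype f‖ ≤ 1 / (1 - ε) := by
  refine ⟨⟨FBL.isBanachLatticeHom_map _, 1 / 2, by norm_num, fun f => ?_⟩, fun h => ?_,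
    fun ε h0 h1 => ⟨witness ε, le_norm_witness h0, (norm_map_witness_le h0).trans ?_⟩⟩
  · linarith [norm_le_two_mul_norm_map f]
  -- At `ε = 1/2` the witness has norm at least `4/3`, while its image has norm at most 1.
  · have h1 := le_norm_witness (ε := 1 / 2) (by norm_num)
    have h2 := norm_map_witness_le (ε := 1 / 2) (by norm_num)
    rw [h.norm_map_of_map_zero (map_zero _)] at h2
    norm_num at h1
    linarith
  · rw [le_div_iff₀ (by linarith)]
    linarith
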